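/- Conventions. Let $G$ be a finite group. A $G$-space is a topological space with a continuous $G$-action. A $G$-invariant subspace $A$ is $G$-contractible if for some $x\in A$ the orbit $Gx$ is a $G$-deformation retract of $A$ (i.e. $\mathrm{id}_A$ is homotopic, through $G$-maps $A\to A$, to a retraction of $A$ onto $Gx$). A regular open $G$-cover of a $G$-space $Y$ is an open cover $\mathcal U$ with $gU\in\mathcal U$ for all $g\in G$, $U\in\mathcal U$, such that (1) for $U\in\mathcal U$, $g\in G$ either $gU=U$ or $U\cap gU=\emptyset$; (2) if $U_0,\dots,U_n\in\mathcal U$ and $g_0,\dots,g_n\in G$ satisfy $\bigcap_i U_i\ne\emptyset$ and $\bigcap_i g_iU_i\neq\emptyset$, then there is $g\in G$ with $gU_i=g_iU_i$ for all $i$. It is a good $G$-cover if moreover all saturations $GU=\bigcup_{g\in G}gU$ ($U\in\mathcal U$) and all their non-empty finite intersections are $G$-contractible. The strict $G$-covering type $\mathrm{sct}_G(Y)\in\{0,1,2,\dots,\infty\}$ is the minimal number of $G$-orbits in a good $G$-cover of $Y$ ($\infty$ if no good $G$-cover has finitely many orbits), and the $G$-covering type of a $G$-space $X$ is $\mathrm{ct}_G(X)=\min\{\mathrm{sct}_G(Y)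 : Y \text{ a } G\text{-space } G\text{-homotopy equivalent to } X\}$. Proposition. Let $p_1,\dots,p_r$ be distinct primes, $k_1,\dots,k_r\ge 0$ integers, $m=\prod_{i=1}^r p_i^{k_i}$, $G=\mathbb Z_m$ and $G_i=\mathbb Z_{p_i^{k_i}}$. For each $i$ let $V_i$ be a finite-dimensional real orthogonal representation of $G_i$, regarded also as an orthogonal representation of $G$ through the canonical projection $G\to G_i$ (reduction modulo $p_i^{k_i}$), and assume that $V_i^G=\{0\}$. Let $S(\cdot)$ denote the unit sphere of an orthogonal representation. Then $$\mathrm{ct}_G\bigl(S(V_1\oplus\cdots\oplus V_r)\bigr)=\sum_{i=1}^r \mathrm{ct}_{G_i}\bigl(S(V_i)\bigr).$$ -/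

import Mathlib

open scoped Pointwise unitInterval

namespace EquivCov

universe u

/-! ### Equivariant maps and homotopies

A `G`-space is a topological space with an action of the (discrete, finite) group `G` by continuous
maps: `[TopologicalSpace X] [MulAction G X] [ContinuousConstSMul G X]`. -/

/-- `f` is a `G`-map (continuity is bundled in `C(X, Y)`). -/
def IsGMap (G : Type*) {X Y : Type*} [Group G] [TopologicalSpace X] [MulAction G X]
    [TopologicalSpace Y] [MulAction G Y] (f : C(X, Y)) : Prop :=
  ∀ (g : G) (x : X), f (g • x) = g • f x

/-- `f₀` and `f₁` are `G`-homotopic: joined by a homotopy through `G`-maps. -/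
def GHomotopic (G : Type*) {X Y : Type*} [Group G] [TopologicalSpace X] [MulAction G X]
    [TopologicalSpace Y] [MulAction G Y] (f₀ f₁ : C(X, Y)) : Prop :=
  ∃ H : ContinuousMap.Homotopy f₀ f₁, ∀ (g : G) (t : I) (x : X), H (t, g • x) = g • H (t, x)

/-- `X` and `Y` are `G`-homotopy equivalent. -/
def GHomotopyEquivalent (G X Y : Type*) [Group G] [TopologicalSpace X] [MulAction G X]
    [TopologicalSpace Y] [MulAction G Y] : Prop :=
  ∃ (f : C(X, Y)) (f' : C(Y, X)), IsGMap G f ∧ IsGMap G f' ∧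
    GHomotopic G (f'.comp f) (ContinuousMap.id X) ∧
    GHomotopic G (f.comp f') (ContinuousMap.id Y)

/-- The saturation `G U = ⋃ g, g U` of a subset of a `G`-space. -/
def saturation (G : Type*) {X : Type*} [Group G] [MulAction G X] (U : Set X) : Set X :=
  ⋃ g : G, g • U

/-- The `G`-invariant subspace `A` is `G`-contractible: for some `x ∈ A` the orbit `G x` is a
`G`-deformation retract of `A`, i.e. there is a homotopy `H t : A → A` through `G`-maps from the
identity of `A` to a retraction of `A` onto `G x`.  (Only the values of `H t` on `A` matter.) -/
def IsGContractible (G : Type*) {X : Type*} [Group G] [TopologicalSpace X] [MulAction G X]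
    (A : Set X) : Prop :=
  ∃ x ∈ A, ∃ H : I → X → X,
    ContinuousOn (fun q : I × X => H q.1 q.2) (Set.univ ×ˢ A) ∧
    (∀ t, Set.MapsTo (H t) A A) ∧
    (∀ (g : G) (t : I), ∀ a ∈ A, H t (g • a) = g • H t a) ∧
    (∀ a ∈ A, H 0 a = a) ∧
    (∀ a ∈ A, H 1 a ∈ MulAction.orbit G x) ∧
    (∀ a ∈ MulAction.orbit G x, H 1 a = a)

/-! ### Good covers and covering type -/

/-- `𝒰` is a regular open `G`-cover of the `G`-space `X`. -/
structure IsRegularGCover (G : Type*) {X : Type*} [Group G] [TopologicalSpace X] [MulAction G X]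
    (𝒰 : Set (Set X)) : Prop where
  isOpen : ∀ U ∈ 𝒰, IsOpen U
  covers : ⋃₀ 𝒰 = Set.univ
  smul_mem : ∀ (g : G), ∀ U ∈ 𝒰, g • U ∈ 𝒰
  eq_or_disjoint : ∀ U ∈ 𝒰, ∀ g : G, g • U = U ∨ U ∩ g • U = ∅
  exists_smul_eq : ∀ (n : ℕ) (U : Fin (n + 1) → Set X) (g : Fin (n + 1) → G),
    (∀ i, U i ∈ 𝒰) → (⋂ i, U i).Nonempty → (⋂ i, g i • U i).Nonempty →
      ∃ h : G, ∀ i, h • U i = g i • U i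

/-- `𝒰` is a good `G`-cover: a regular open `G`-cover such that the saturations `G U`, `U ∈ 𝒰`, and
all their non-empty finite intersections are `G`-contractible. -/
structure IsGoodGCover (G : Type*) {X : Type*} [Group G] [TopologicalSpace X] [MulAction G X]
    (𝒰 : Set (Set X)) : Prop extends IsRegularGCover G 𝒰 where
  contractible : ∀ U ∈ 𝒰, IsGContractible G (saturation G U)
  contractible_inter : ∀ (n : ℕ) (U : Fin (n + 1) → Set X), (∀ i, U i ∈ 𝒰) →
    (⋂ i, saturation G (U i)).Nonempty → IsGContractible G (⋂ i, saturation G (U i))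

/-- The strict `G`-covering type: the least number of `G`-orbits of a good `G`-cover of `X`
(`⊤` if there is no good `G`-cover with finitely many orbits). -/
noncomputable def sct (G X : Type*) [Group G] [TopologicalSpace X] [MulAction G X] : ℕ∞ :=
  ⨅ (𝒰 : Set (Set X)) (_ : IsGoodGCover G 𝒰), ((fun U => MulAction.orbit G U) '' 𝒰).encard

/-- The `G`-covering type: the least strict `G`-covering type of a `G`-space `Y` that is
`G`-homotopy equivalent to `X`. -/
noncomputable def ct (G : Type*) (X : Type u) [Group G] [TopologicalSpace X] [MulAction G X] :
    ℕ∞ :=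
  ⨅ (Y : Type u) (_ : TopologicalSpace Y) (_ : MulAction G Y) (_ : ContinuousConstSMul G Y)
    (_ : GHomotopyEquivalent G X Y), sct G Y

/-! ### Orthogonal representations and their unit spheres -/

section Sphere

variable {G V : Type*} [Group G] [NormedAddCommGroup V] [InnerProductSpace ℝ V]

/-- The unit sphere `S(V)` of the orthogonal representation `ρ` of `G` on `V`, a `G`-space. -/
def RepSphere (ρ : G →* (V ≃ₗᵢ[ℝ] V)) : Type _ :=
  let _ := ρ
  Metric.sphere (0 : V) 1

instance (ρ : G →* (V ≃ₗᵢ[ℝ] V)) : TopologicalSpace (RepSphere ρ) :=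
  inferInstanceAs (TopologicalSpace (Metric.sphere (0 : V) 1))

instance (ρ : G →* (V ≃ₗᵢ[ℝ] V)) : MulAction G (RepSphere ρ) where
  smul g x := (⟨ρ g x.1, by have hx := x.2; simpa using hx⟩ : Metric.sphere (0 : V) 1)
  one_smul x := Subtype.ext (by
    change ρ 1 x.1 = x.1
    simp)
  mul_smul g h x := Subtype.ext (by
    change ρ (g * h) x.1 = ρ g (ρ h x.1)
    simp)

instance (ρ : G →* (V ≃ₗᵢ[ℝ] V)) : ContinuousConstSMul G (RepSphere ρ) where
  continuous_const_smul g :=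
    Continuous.subtype_mk ((ρ g).continuous.comp continuous_subtype_val) _

end Sphere

/-- The orthogonal direct sum of finitely many orthogonal representations. -/
noncomputable def directSum {G : Type*} [Group G] {r : ℕ} {V : Fin r → Type*}
    [∀ i, NormedAddCommGroup (V i)] [∀ i, InnerProductSpace ℝ (V i)]
    (ρ : ∀ i, G →* (V i ≃ₗᵢ[ℝ] V i)) : G →* (PiLp 2 V ≃ₗᵢ[ℝ] PiLp 2 V) where
  toFun g := LinearIsometryEquiv.piLpCongrRight 2 (fun i => ρ i g)
  map_one' := by
    ext v i
    simp
  map_mul' g h := by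
    ext v i
    simp

/-- The canonical projection `ℤ/m → ℤ/n` for `n ∣ m`, for the groups written multiplicatively. -/
def cyclicProj {m n : ℕ} (h : n ∣ m) : Multiplicative (ZMod m) →* Multiplicative (ZMod n) :=
  AddMonoidHom.toMultiplicative (ZMod.castHom h (ZMod n)).toAddMonoidHom

/-- The projection of the cyclic group of order `m = ∏ i, p i ^ k i` onto its `i`-th factor, the
cyclic group of order `p i ^ k i`. -/
def projFactor {r : ℕ} (p k : Fin r → ℕ) (i : Fin r) :
    Multiplicative (ZMod (∏ j, p j ^ k j)) →* Multiplicative (ZMod (p i ^ k i)) :=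
  cyclicProj (Finset.dvd_prod_of_mem (fun j => p j ^ k j) (Finset.mem_univ i))

end EquivCov

namespace EquivCov

open Set Filter Topology

/-! ### Composition of equivariant homotopies -/

section Homotopy

variable {G X Y Z : Type*} [Group G] [TopologicalSpace X] [MulAction G X] [TopologicalSpace Y]
  [MulAction G Y] [TopologicalSpace Z] [MulAction G Z]

/-! All that matters about the projections `q i : G → Γ i` is joint surjectivity, which gives ker (q
i) · ker (q j) = G for i ≠ j, together with the absence of nonzero fixed vectors. In this generality
the theorem is `ct_repSphere_directSum`.

Lower bound (`sum_ct_le_ct`): a good G-cover of Y ≃ S(⊕ V i) restricts to a good `Γ i`-cover of the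
points fixed by ker (q i), and this fixed set is equivalent to S(V i). If a member, or translates of
it, met two of these fixed sets, its saturation would contract onto an orbit containing a point
fixed by both kernels, hence by G. But S(⊕ V i), and so Y, has no G-fixed point. Thus different i
use disjoint sets of orbits of members.

Upper bound (`ct_le_sum_ct`): S(⊕ V i) is the join of the S(V i) up to equivalence, and each S(V i)
may be replaced by an optimal model `Y i`. The cylinders over members of good covers of the `Y i`
form a good G-cover of the join (`isGoodGCover_joinCover`): an intersection of their saturations
contracts onto a product of `Γ i`-orbits, which joint surjectivity makes a single G-orbit. -/

theorem GHomotopic.of_fun {f₀ f₁ : C(X, Y)} (H : I × X → Y) (hH : Continuous H)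
    (h₀ : ∀ x, H (0, x) = f₀ x) (h₁ : ∀ x, H (1, x) = f₁ x)
    (hg : ∀ (g : G) (t : I) (x : X), H (t, g • x) = g • H (t, x)) : GHomotopic G f₀ f₁ :=
  ⟨{ toFun := H, continuous_toFun := hH, map_zero_left := h₀, map_one_left := h₁ }, hg⟩

theorem GHomotopic.of_eq {f₀ f₁ : C(X, Y)} (hf : IsGMap G f₀) (h : ∀ x, f₀ x = f₁ x) :
    GHomotopic G f₀ f₁ :=
  .of_fun (fun p => f₀ p.2) (by fun_prop) (fun _ => rfl) h fun g _ x => hf g x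

theorem GHomotopic.trans {f₀ f₁ f₂ : C(X, Y)} (h : GHomotopic G f₀ f₁)
    (h' : GHomotopic G f₁ f₂) : GHomotopic G f₀ f₂ := by
  obtain ⟨H, hH⟩ := h
  obtain ⟨H', hH'⟩ := h'
  refine ⟨H.trans H', fun g t x => ?_⟩
  simp only [ContinuousMap.Homotopy.trans_apply]
  split_ifs
  · exact hH ..
  · exact hH' ..

theorem GHomotopic.conj {W : Type*} [TopologicalSpace W] [MulAction G W] {f₀ f₁ : C(X, Y)}
    (h : GHomotopic G f₀ f₁) {k : C(W, X)} (hk : IsGMap G k) {l : C(Y, Z)} (hl : IsGMap G l) :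
    GHomotopic G (l.comp (f₀.comp k)) (l.comp (f₁.comp k)) := by
  obtain ⟨H, hH⟩ := h
  exact .of_fun (fun p => l (H (p.1, k p.2))) (by fun_prop) (by simp) (by simp)
    fun g t x => by rw [hk, hH, hl]

theorem GHomotopyEquivalent.trans (h : GHomotopyEquivalent G X Y)
    (h' : GHomotopyEquivalent G Y Z) : GHomotopyEquivalent G X Z := by
  obtain ⟨f, f', hf, hf', h₁, h₂⟩ := h
  obtain ⟨k, k', hk, hk', h₃, h₄⟩ := h'
  refine ⟨k.comp f, f'.comp k', fun g x => ?_, fun g x => ?_, ?_, ?_⟩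
  · simp [hf g, hk g]
  · simp [hf' g, hk' g]
  · exact (h₃.conj hf hf').trans h₁
  · exact (h₂.conj hk' hk).trans h₄

end Homotopy

/-! ### Elementary properties of good covers -/

theorem IsGoodGCover.nonempty {G X : Type*} [Group G] [TopologicalSpace X] [MulAction G X]
    {𝒰 : Set (Set X)} (h : IsGoodGCover G 𝒰) {U : Set X} (hU : U ∈ 𝒰) : U.Nonempty := by
  obtain ⟨x, hx, -⟩ := h.contractible U hU
  obtain ⟨g, hg⟩ := mem_iUnion.1 hx
  exact Set.smul_set_nonempty.1 ⟨x, hg⟩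

/-- Contractibility of single saturations is the case n = 0 of intersections, once the members are
nonempty. -/
theorem IsRegularGCover.isGoodGCover {G X : Type*} [Group G] [TopologicalSpace X] [MulAction G X]
    {𝒰 : Set (Set X)} (h : IsRegularGCover G 𝒰) (hne : ∀ U ∈ 𝒰, U.Nonempty)
    (hc : ∀ (n : ℕ) (U : Fin (n + 1) → Set X), (∀ i, U i ∈ 𝒰) →
      (⋂ i, saturation G (U i)).Nonempty → IsGContractible G (⋂ i, saturation G (U i))) :
    IsGoodGCover G 𝒰 where
  toIsRegularGCover := h
  contractible_inter := hc
  contractible U hU := by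
    have h1 := hc 0 (fun _ => U) (fun _ => hU)
    simp only [iInter_const] at h1
    refine h1 ((hne U hU).mono fun x hx => mem_iUnion.2 ⟨1, ?_⟩)
    simpa using hx

/-! ### Points fixed by the kernel of a surjection -/

section Saturation

variable {G X : Type*} [Group G] [MulAction G X]

theorem mem_saturation {U : Set X} {x : X} : x ∈ saturation G U ↔ ∃ g : G, g • x ∈ U := by
  simp only [saturation, mem_iUnion, mem_smul_set_iff_inv_smul_mem]
  exact ⟨fun ⟨g, h⟩ => ⟨g⁻¹, h⟩, fun ⟨g, h⟩ => ⟨g⁻¹, by simpa using h⟩⟩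

theorem smul_mem_saturation {U : Set X} {x : X} (g : G) (hx : x ∈ saturation G U) :
    g • x ∈ saturation G U := by
  obtain ⟨a, ha⟩ := mem_saturation.1 hx
  exact mem_saturation.2 ⟨a * g⁻¹, by simpa [smul_smul] using ha⟩

end Saturation

section KerFixed

variable {G Q : Type*} [Group G] [Group Q]

/-- The points of a `G`-space fixed by the kernel of the surjection `q : G → Q`, a `Q`-space. -/
@[ext]
structure KerFixed (q : G →* Q) (hq : Function.Surjective q) (X : Type*) [MulAction G X] where
  /-- The underlying point. -/
  val : X
  smul_val : ∀ g, q g = 1 → g • val = val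

section Algebra

variable {q : G →* Q} {hq : Function.Surjective q} {X : Type*} [MulAction G X]

theorem smul_mem_kerFixed {x : X} (hx : ∀ g, q g = 1 → g • x = x) (a : G) :
    ∀ g, q g = 1 → g • a • x = a • x := fun g hg => by
  have := hx (a⁻¹ * g * a) (by simp [hg])
  rw [smul_smul, show g * a = a * (a⁻¹ * g * a) by group, mul_smul, this]

theorem smul_eq_of_map_eq {x : X} (hx : ∀ g, q g = 1 → g • x = x) {a b : G} (h : q a = q b) :
    a • x = b • x := by
  have := hx (b⁻¹ * a) (by simp [h])
  rw [mul_smul, inv_smul_eq_iff] at this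
  exact this

/-- The kernel is normal, so being fixed by it passes along orbits. It is applied to the end point
of a contraction. -/
theorem smul_eq_of_mem_orbit {x z : X} (h : z ∈ MulAction.orbit G x)
    (hz : ∀ g, q g = 1 → g • z = z) : ∀ g, q g = 1 → g • x = x := by
  obtain ⟨a, rfl⟩ := h
  simpa using smul_mem_kerFixed hz a⁻¹

/-- The section `surjInv` is no homomorphism, but on points fixed by the kernel the action of a lift
depends only on its image in `Q`. -/
noncomputable instance : MulAction Q (KerFixed q hq X) where
  smul a x := ⟨Function.surjInv hq a • x.val, smul_mem_kerFixed x.smul_val _⟩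
  one_smul x := KerFixed.ext (x.smul_val _ (Function.surjInv_eq hq 1))
  mul_smul a b x := KerFixed.ext (by
    change Function.surjInv hq (a * b) • x.val =
      Function.surjInv hq a • Function.surjInv hq b • x.val
    rw [smul_smul]
    exact smul_eq_of_map_eq x.smul_val (by simp [Function.surjInv_eq]))

theorem KerFixed.val_map_smul (g : G) (x : KerFixed q hq X) : (q g • x).val = g • x.val :=
  smul_eq_of_map_eq x.smul_val (Function.surjInv_eq hq _)

theorem KerFixed.smul_preimage (g : G) (U : Set X) :
    q g • (val ⁻¹' U : Set (KerFixed q hq X)) = val ⁻¹' (g • U) := by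
  ext x
  rw [mem_smul_set_iff_inv_smul_mem, mem_preimage, mem_preimage, mem_smul_set_iff_inv_smul_mem,
    ← map_inv, val_map_smul]

theorem KerFixed.saturation_preimage (U : Set X) :
    saturation Q (val ⁻¹' U : Set (KerFixed q hq X)) = val ⁻¹' (saturation G U) := by
  simp only [saturation, preimage_iUnion, ← smul_preimage]
  exact (hq.iUnion_comp fun a => a • (val ⁻¹' U : Set (KerFixed q hq X))).symm

end Algebra

variable {q : G →* Q} {hq : Function.Surjective q} {X Y : Type*} [TopologicalSpace X]
  [MulAction G X] [TopologicalSpace Y] [MulAction G Y]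

instance : TopologicalSpace (KerFixed q hq X) := .induced KerFixed.val inferInstance

theorem KerFixed.isInducing_val : IsInducing (KerFixed.val : KerFixed q hq X → X) := ⟨rfl⟩

instance [ContinuousConstSMul G X] : ContinuousConstSMul Q (KerFixed q hq X) where
  continuous_const_smul _ :=
    KerFixed.isInducing_val.continuous_iff.2 (KerFixed.isInducing_val.continuous.const_smul _)

/-- The restriction of a `G`-map to the points fixed by the kernel of `q`. -/
def KerFixed.map (f : C(X, Y)) (hf : IsGMap G f) : C(KerFixed q hq X, KerFixed q hq Y) where
  toFun x := ⟨f x.val, fun g hg => by rw [← hf, x.smul_val g hg]⟩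
  continuous_toFun :=
    isInducing_val.continuous_iff.2 (f.continuous.comp isInducing_val.continuous)

theorem KerFixed.isGMap_map (f : C(X, Y)) (hf : IsGMap G f) :
    IsGMap Q (KerFixed.map (q := q) (hq := hq) f hf) := fun a x => by
  obtain ⟨g, rfl⟩ := hq a
  refine KerFixed.ext ?_
  rw [val_map_smul]
  change f (q g • x).val = g • f x.val
  rw [val_map_smul, hf]

theorem GHomotopic.kerFixed {f k : C(X, Y)} {hf : IsGMap G f} {hk : IsGMap G k}
    (h : GHomotopic G f k) :
    GHomotopic Q (KerFixed.map (q := q) (hq := hq) f hf) (KerFixed.map k hk) := by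
  obtain ⟨H, hH⟩ := h
  refine .of_fun (fun p => ⟨H (p.1, p.2.val), fun g hg => ?_⟩) ?_ (fun x => KerFixed.ext ?_)
    (fun x => KerFixed.ext ?_) fun a t x => KerFixed.ext ?_
  · rw [← hH, p.2.smul_val g hg]
  · exact KerFixed.isInducing_val.continuous_iff.2 (H.continuous.comp
      (continuous_fst.prodMk (KerFixed.isInducing_val.continuous.comp continuous_snd)))
  · exact H.apply_zero _
  · exact H.apply_one _
  · obtain ⟨g, rfl⟩ := hq a
    simp only [KerFixed.val_map_smul, hH]

theorem GHomotopyEquivalent.kerFixed (q : G →* Q) (hq : Function.Surjective q)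
    (h : GHomotopyEquivalent G X Y) :
    GHomotopyEquivalent Q (KerFixed q hq X) (KerFixed q hq Y) := by
  obtain ⟨f, f', hf, hf', h₁, h₂⟩ := h
  refine ⟨KerFixed.map f hf, KerFixed.map f' hf', KerFixed.isGMap_map f hf,
    KerFixed.isGMap_map f' hf', ?_, ?_⟩
  · exact GHomotopic.kerFixed (hf := fun g x => by simp [hf g, hf' g]) (hk := fun _ _ => rfl) h₁
  · exact GHomotopic.kerFixed (hf := fun g x => by simp [hf g, hf' g]) (hk := fun _ _ => rfl) h₂

/-- An equivariant homotopy preserves the fixed points of the kernel. A fixed point of `A` ends in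
the orbit of `x`, so `x` is itself fixed and the contraction restricts. -/
theorem IsGContractible.kerFixed {A : Set X} (hA : IsGContractible G A)
    (hinv : ∀ g : G, ∀ a ∈ A, g • a ∈ A)
    (hne : (KerFixed.val ⁻¹' A : Set (KerFixed q hq X)).Nonempty) :
    IsGContractible Q (KerFixed.val ⁻¹' A : Set (KerFixed q hq X)) := by
  classical
  obtain ⟨x, hx, H, hc, hm, hG, h0, h1, h1'⟩ := hA
  obtain ⟨y, hy⟩ := hne
  have hf : ∀ t, ∀ z : KerFixed q hq X, z.val ∈ A → ∀ g, q g = 1 → g • H t z.val = H t z.val :=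
    fun t z hz g hg => by rw [← hG g t _ hz, z.smul_val g hg]
  have hxf : ∀ g, q g = 1 → g • x = x := smul_eq_of_mem_orbit (h1 y.val hy) (hf 1 y hy)
  -- The value off `A` is arbitrary, since contractibility only sees `A`.
  let K : I → KerFixed q hq X → KerFixed q hq X := fun t z =>
    if hz : z.val ∈ A then ⟨H t z.val, hf t z hz⟩ else z
  have hK : ∀ t z, z.val ∈ A → (K t z).val = H t z.val := fun t z hz => by
    change (dite _ _ _ : KerFixed q hq X).val = _
    rw [dif_pos hz]
  have horb : ∀ z : KerFixed q hq X,
      z ∈ MulAction.orbit Q (⟨x, hxf⟩ : KerFixed q hq X) ↔ z.val ∈ MulAction.orbit G x := by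
    intro z
    constructor
    · rintro ⟨a, rfl⟩
      obtain ⟨g, rfl⟩ := hq a
      exact ⟨g, (KerFixed.val_map_smul g (⟨x, hxf⟩ : KerFixed q hq X)).symm⟩
    · rintro ⟨g, hg⟩
      exact ⟨q g, KerFixed.ext ((KerFixed.val_map_smul g _).trans hg)⟩
  refine ⟨⟨x, hxf⟩, hx, K, ?_, fun t z hz => ?_, fun a t z hz => KerFixed.ext ?_,
    fun z hz => KerFixed.ext ?_, fun z hz => ?_, fun z hz => KerFixed.ext ?_⟩
  · rw [KerFixed.isInducing_val.continuousOn_iff]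
    refine ContinuousOn.congr (f := fun p : I × KerFixed q hq X => H p.1 p.2.val) ?_
      fun p hp => hK p.1 p.2 hp.2
    exact hc.comp (f := fun p : I × KerFixed q hq X => (p.1, p.2.val)) (continuous_fst.prodMk
      (KerFixed.isInducing_val.continuous.comp continuous_snd)).continuousOn fun p hp => hp
  · rw [mem_preimage, hK t z hz]
    exact hm t hz
  · obtain ⟨g, rfl⟩ := hq a
    have hz' : (q g • z).val ∈ A := by
      rw [KerFixed.val_map_smul]
      exact hinv g _ hz
    rw [hK t _ hz', KerFixed.val_map_smul, KerFixed.val_map_smul, hK t z hz, hG g t _ hz]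
  · rw [hK 0 z hz, h0 _ hz]
  · rw [horb, hK 1 z hz]
    exact h1 _ hz
  · have h := (horb z).1 hz
    have hzA : z.val ∈ A := by
      obtain ⟨g, hg⟩ := h
      rw [← hg]
      exact hinv g x hx
    rw [hK 1 z hzA, h1' _ h]

/-- The restriction of a cover of a `G`-space to the points fixed by the kernel of `q`. -/
def restrictCover (q : G →* Q) (hq : Function.Surjective q) (𝒰 : Set (Set X)) :
    Set (Set (KerFixed q hq X)) :=
  {W | W.Nonempty ∧ ∃ U ∈ 𝒰, KerFixed.val ⁻¹' U = W}

/-- Taking traces commutes with translation and saturation, so each condition is inherited after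
lifting elements of `Q` to `G`. Empty traces are discarded because they are not contractible. -/
theorem IsGoodGCover.restrictCover {𝒰 : Set (Set X)} (h : IsGoodGCover G 𝒰) :
    IsGoodGCover Q (restrictCover q hq 𝒰) := by
  refine IsRegularGCover.isGoodGCover ⟨?_, ?_, ?_, ?_, ?_⟩ (fun U hU => hU.1) ?_
  · rintro _ ⟨-, U, hU, rfl⟩
    exact (h.isOpen U hU).preimage KerFixed.isInducing_val.continuous
  · refine eq_univ_of_forall fun x => ?_
    obtain ⟨U, hU, hx⟩ := h.covers.symm ▸ mem_univ x.val
    exact ⟨_, ⟨⟨x, hx⟩, U, hU, rfl⟩, hx⟩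
  · rintro a _ ⟨hne, U, hU, rfl⟩
    obtain ⟨g, rfl⟩ := hq a
    exact ⟨hne.smul_set, g • U, h.smul_mem g U hU, (KerFixed.smul_preimage g U).symm⟩
  · rintro _ ⟨hne, U, hU, rfl⟩ a
    obtain ⟨g, rfl⟩ := hq a
    rw [KerFixed.smul_preimage, ← preimage_inter]
    rcases h.eq_or_disjoint U hU g with h' | h'
    · exact .inl (by rw [h'])
    · exact .inr (by rw [h', preimage_empty])
  · intro n W a hW h₁ h₂
    choose hne U hU hUW using hW
    obtain rfl : (fun i => KerFixed.val ⁻¹' U i) = W := funext hUW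
    choose g hg using fun i => hq (a i)
    obtain rfl : (fun i => q (g i)) = a := funext hg
    simp only [KerFixed.smul_preimage, ← preimage_iInter] at h₁ h₂ ⊢
    obtain ⟨x, hx⟩ := h₁
    obtain ⟨y, hy⟩ := h₂
    obtain ⟨b, hb⟩ := h.exists_smul_eq n U g hU ⟨_, hx⟩ ⟨_, hy⟩
    exact ⟨q b, fun i => by rw [KerFixed.smul_preimage, hb i]⟩
  · intro n W hW hne
    choose _ U hU hUW using hW
    obtain rfl : (fun i => KerFixed.val ⁻¹' U i) = W := funext hUW
    simp only [KerFixed.saturation_preimage, ← preimage_iInter] at hne ⊢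
    obtain ⟨x, hx⟩ := hne
    exact (h.contractible_inter n U hU ⟨_, hx⟩).kerFixed (fun g a ha => mem_iInter.2 fun i =>
      smul_mem_saturation g (mem_iInter.1 ha i)) ⟨x, hx⟩

end KerFixed

/-! ### The lower bound -/

section LowerBound

/-- The contraction carries `y` and `y'` into the orbit of `x`, so `x` is fixed by both kernels, and
these generate `G`. -/
theorem IsGContractible.exists_forall_smul_eq {G Q Q' X : Type*} [Group G] [Group Q] [Group Q']
    [TopologicalSpace X] [MulAction G X] {A : Set X} (hA : IsGContractible G A) {q : G →* Q}
    {q' : G →* Q'} (hqq' : ∀ g, ∃ a b, g = a * b ∧ q a = 1 ∧ q' b = 1) {y y' : X} (hy : y ∈ A)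
    (hy' : y' ∈ A) (hqy : ∀ g, q g = 1 → g • y = y) (hqy' : ∀ g, q' g = 1 → g • y' = y') :
    ∃ x : X, ∀ g : G, g • x = x := by
  obtain ⟨x, hx, H, -, -, hG, -, h1, -⟩ := hA
  have hx' := smul_eq_of_mem_orbit (h1 y' hy') fun g hg => by rw [← hG g 1 y' hy', hqy' g hg]
  have hx'' := smul_eq_of_mem_orbit (h1 y hy) fun g hg => by rw [← hG g 1 y hy, hqy g hg]
  refine ⟨x, fun g => ?_⟩
  obtain ⟨a, b, rfl, ha, hb⟩ := hqq' g
  rw [mul_smul, hx' b hb, hx'' a ha]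

variable {ι : Type*} {G : Type*} [Group G] {Γ : ι → Type*} [∀ i, Group (Γ i)]

theorem surjective_of_jointly {q : ∀ i, G →* Γ i}
    (hq : Function.Surjective fun g i => q i g) (i : ι) : Function.Surjective (q i) := by
  classical
  intro a
  obtain ⟨g, hg⟩ := hq (Function.update 1 i a)
  exact ⟨g, by simpa using congrFun hg i⟩

/-- Joint surjectivity provides `a` with trivial `i`-th image and the same `j`-th image as `g`. -/
theorem exists_eq_mul_of_jointly {q : ∀ i, G →* Γ i}
    (hq : Function.Surjective fun g i => q i g) {i j : ι} (hij : i ≠ j) (g : G) :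
    ∃ a b, g = a * b ∧ q i a = 1 ∧ q j b = 1 := by
  classical
  obtain ⟨a, ha⟩ := hq (Function.update (fun l => q l g) i 1)
  have hi := congrFun ha i
  have hj := congrFun ha j
  simp only [Function.update_self, Function.update_of_ne hij.symm] at hi hj
  exact ⟨a, a⁻¹ * g, by group, hi, by simp [hj]⟩

theorem sum_ct_le_ct [Fintype ι] {q : ∀ i, G →* Γ i}
    (hq : Function.Surjective fun g i => q i g) {X : Type u} [TopologicalSpace X]
    [MulAction G X] (hX : ∀ x : X, ∃ g : G, g • x ≠ x) {S : ι → Type u}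
    [∀ i, TopologicalSpace (S i)] [∀ i, MulAction (Γ i) (S i)]
    (hS : ∀ i, GHomotopyEquivalent (Γ i) (S i) (KerFixed (q i) (surjective_of_jointly hq i) X)) :
    ∑ i, ct (Γ i) (S i) ≤ ct G X := by
  refine le_iInf fun Y => le_iInf fun _ => le_iInf fun _ => le_iInf fun _ => le_iInf fun hXY =>
    le_iInf fun 𝒰 => le_iInf fun h𝒰 => ?_
  have hY : ¬ ∃ y : Y, ∀ g : G, g • y = y := by
    rintro ⟨y, hy⟩
    obtain ⟨-, f', -, hf', -⟩ := hXY
    obtain ⟨g, hg⟩ := hX (f' y)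
    exact hg (by rw [← hf', hy])
  let T : ∀ i, Set (Set Y) := fun i =>
    {U | U ∈ 𝒰 ∧ (KerFixed.val ⁻¹' U :
      Set (KerFixed (q i) (surjective_of_jointly hq i) Y)).Nonempty}
  let O : ι → Set (Set (Set Y)) := fun i => (fun U => MulAction.orbit G U) '' T i
  have hO : Pairwise (Function.onFun Disjoint O) := by
    intro i j hij
    refine Set.disjoint_left.2 ?_
    rintro _ ⟨U, ⟨hU, y, hy⟩, rfl⟩ ⟨U', ⟨hU', y', hy'⟩, hUU'⟩
    -- Equal orbits make `U'` a translate of `U`, so `y` and `y'` both lie in the saturation of `U`.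
    obtain ⟨g, rfl⟩ : U' ∈ MulAction.orbit G U := by
      rw [← show MulAction.orbit G U' = MulAction.orbit G U from hUU']
      exact MulAction.mem_orbit_self U'
    exact hY ((h𝒰.contractible U hU).exists_forall_smul_eq (exists_eq_mul_of_jointly hq hij)
      (mem_iUnion.2 ⟨1, by simpa using hy⟩) (mem_iUnion.2 ⟨g, hy'⟩) y.smul_val y'.smul_val)
  have hle : ∀ i, ct (Γ i) (S i) ≤ (O i).encard := by
    intro i
    refine (iInf_le_of_le (KerFixed (q i) (surjective_of_jointly hq i) Y) <|
      iInf_le_of_le inferInstance <| iInf_le_of_le inferInstance <|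
      iInf_le_of_le inferInstance <| iInf_le_of_le ((hS i).trans (hXY.kerFixed _ _)) <|
      iInf_le_of_le (restrictCover (q i) (surjective_of_jointly hq i) 𝒰) <|
      iInf_le_of_le h𝒰.restrictCover ?_)
    -- The orbit of a trace consists of the traces of the orbit, so restriction creates no more
    -- orbits than `O i` has.
    refine (encard_le_encard ?_).trans
      (encard_image_le (fun o => (fun U => KerFixed.val ⁻¹' U) '' o) (O i))
    rintro _ ⟨_, ⟨hne, U, hU, rfl⟩, rfl⟩
    refine ⟨_, ⟨U, ⟨hU, hne⟩, rfl⟩, ?_⟩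
    ext W
    constructor
    · rintro ⟨_, ⟨g, rfl⟩, rfl⟩
      exact ⟨q i g, KerFixed.smul_preimage g U⟩
    · rintro ⟨a, rfl⟩
      obtain ⟨g, rfl⟩ := surjective_of_jointly hq i a
      exact ⟨_, ⟨g, rfl⟩, (KerFixed.smul_preimage g U).symm⟩
  calc ∑ i, ct (Γ i) (S i) ≤ ∑ i, (O i).encard := Finset.sum_le_sum fun i _ => hle i
    _ = (⋃ i, O i).encard := by rw [encard_iUnion_of_finite hO, finsum_eq_sum_of_fintype]
    _ ≤ _ := encard_le_encard <| iUnion_subset fun i => image_mono fun U hU => hU.1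

end LowerBound

/-! ### Adding a point whose only neighbourhood is the whole space -/

/-- The space `Y` with an added point `bot` whose only neighbourhood is the whole space. -/
inductive OpenExt (Y : Type*)
  /-- The added point. -/
  | bot : OpenExt Y
  /-- The inclusion of `Y`. -/
  | of (y : Y) : OpenExt Y

namespace OpenExt

variable {X Y Z T : Type*}

/-- The extension of a map defined on `X` by `bot ↦ bot`. -/
def bind : OpenExt X → (X → OpenExt Y) → OpenExt Y
  | bot, _ => bot
  | of x, f => f x

@[simp] theorem bind_bot (f : X → OpenExt Y) : bot.bind f = bot := rfl

@[simp] theorem bind_of (f : X → OpenExt Y) (x : X) : (of x).bind f = f x := rfl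

theorem bind_eq_bot {f : X → OpenExt Y} (hf : ∀ x, f x ≠ bot) (o : OpenExt X) :
    o.bind f = bot ↔ o = bot := by
  cases o <;> simp [hf]

theorem of_injective : Function.Injective (of : Y → OpenExt Y) := fun _ _ h => by
  cases h
  rfl

variable [TopologicalSpace X] [TopologicalSpace Y] [TopologicalSpace Z] [TopologicalSpace T]

instance : TopologicalSpace (OpenExt Y) := .generateFrom {s | ∃ U, IsOpen U ∧ of '' U = s}

theorem isOpen_image_of {U : Set Y} (hU : IsOpen U) : IsOpen (of '' U) :=
  TopologicalSpace.isOpen_generateFrom_of_mem ⟨U, hU, rfl⟩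

theorem isOpenMap_of : IsOpenMap (of : Y → OpenExt Y) := fun _ => isOpen_image_of

/-- Nothing has to be checked near points sent to `bot`. -/
theorem continuous_iff {f : Z → OpenExt Y} :
    Continuous f ↔ ∀ U, IsOpen U → IsOpen (f ⁻¹' (of '' U)) := by
  rw [continuous_generateFrom_iff]
  exact ⟨fun h U hU => h _ ⟨U, hU, rfl⟩, by rintro h _ ⟨U, hU, rfl⟩; exact h U hU⟩

theorem continuous_of : Continuous (of : Y → OpenExt Y) :=
  continuous_iff.2 fun U hU => by rwa [preimage_image_eq U of_injective]

theorem isOpenEmbedding_of : IsOpenEmbedding (of : Y → OpenExt Y) :=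
  .of_continuous_injective_isOpenMap continuous_of of_injective isOpenMap_of

/-- The parameter `T` serves homotopies. As `of` is an open map, so is `id × of`, and no compactness
is needed. -/
theorem continuous_bind {F : T × X → OpenExt Y} (hF : Continuous F) :
    Continuous fun p : T × OpenExt X => p.2.bind fun x => F (p.1, x) := by
  refine continuous_iff.2 fun U hU => ?_
  convert (IsOpenMap.id.prodMap isOpenMap_of) _ (continuous_iff.1 hF U hU) using 1
  ext ⟨t, o⟩
  cases o with
  | bot => simp
  | of x => simp

theorem continuous_dite {W : Set Z} [DecidablePred (· ∈ W)] (hW : IsOpen W) {h : W → Y}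
    (hh : Continuous h) : Continuous fun z => if hz : z ∈ W then of (h ⟨z, hz⟩) else bot := by
  refine continuous_iff.2 fun U hU => ?_
  convert hW.isOpenMap_subtype_val _ (hU.preimage hh) using 1
  ext z
  by_cases hz : z ∈ W <;> simp [hz]

theorem continuous_ite {W : Set Z} [DecidablePred (· ∈ W)] (hW : IsOpen W) {h : Z → Y}
    (hh : ContinuousOn h W) : Continuous fun z => if z ∈ W then of (h z) else bot :=
  continuous_dite hW (continuousOn_iff_continuous_domRestrict.1 hh)

end OpenExt

/-! ### Joins -/

/-- The points of the product of the open cones over the spaces `Y i` other than the product of the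
cone points: a point of the `i`-th cone is given by its radius and, for nonzero radius, a point of
`Y i`.  The product of the groups `Γ i` acts on it, hence so does `G` through the maps `q i`. -/
@[ext]
structure Join {ι : Type*} {G : Type*} [Group G] {Γ : ι → Type*} [∀ i, Group (Γ i)]
    (q : ∀ i, G →* Γ i) (Y : ι → Type*) where
  /-- The radii of the components. -/
  radius : ι → ℝ
  /-- The points of the bases of the cones. -/
  pt : ∀ i, OpenExt (Y i)
  nonneg : ∀ i, 0 ≤ radius i
  pt_eq_bot_iff : ∀ i, pt i = .bot ↔ radius i = 0
  exists_ne : ∃ i, radius i ≠ 0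

namespace Join

variable {ι : Type*} {G : Type*} [Group G] {Γ : ι → Type*} [∀ i, Group (Γ i)]
  {q : ∀ i, G →* Γ i} {X Y : ι → Type*}

theorem radius_pos {p : Join q Y} {i : ι} (h : p.pt i ≠ .bot) : 0 < p.radius i :=
  (p.nonneg i).lt_of_ne' fun h' => h ((p.pt_eq_bot_iff i).2 h')

/-- Functoriality of the join. -/
def map (f : ∀ i, X i → Y i) (p : Join q X) : Join q Y where
  radius := p.radius
  pt i := (p.pt i).bind fun x => .of (f i x)
  nonneg := p.nonneg
  pt_eq_bot_iff i := by rw [OpenExt.bind_eq_bot (by simp), p.pt_eq_bot_iff]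
  exists_ne := p.exists_ne

theorem map_eq_self {f : ∀ i, X i → X i} (hf : ∀ i x, f i x = x) (p : Join q X) :
    map f p = p := by
  ext i
  · rfl
  · simp only [map, hf]
    cases p.pt i <;> rfl

theorem map_map {Z : ι → Type*} (k : ∀ i, Y i → Z i) (f : ∀ i, X i → Y i) (p : Join q X) :
    map k (map f p) = map (fun i x => k i (f i x)) p := by
  ext i
  · rfl
  · simp only [map]
    cases p.pt i <;> rfl

/-- The set of points of the join whose `i`-th component lies over `U`. -/
def cylinder (q : ∀ i, G →* Γ i) (i : ι) (U : Set (Y i)) : Set (Join q Y) :=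
  {p | p.pt i ∈ OpenExt.of '' U}

/-- The cover of the join by the cylinders over the members of covers of its factors. -/
def joinCover (q : ∀ i, G →* Γ i) (𝒰 : ∀ i, Set (Set (Y i))) : Set (Set (Join q Y)) :=
  {W | ∃ i, ∃ U ∈ 𝒰 i, cylinder q i U = W}

/-- Sorts a finite family of cylinders by factor: `s` is the set of factors that occur, and each
gets a family of the same length n + 1, so that the conditions on each `𝒰 j` apply verbatim. -/
theorem exists_of_mem_joinCover {𝒰 : ∀ i, Set (Set (Y i))} {n : ℕ}
    {W : Fin (n + 1) → Set (Join q Y)} (hW : ∀ k, W k ∈ joinCover q 𝒰) :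
    ∃ (s : Set ι) (V : ∀ j, Fin (n + 1) → Set (Y j)) (τ : ι → Fin (n + 1) → Fin (n + 1)),
      s.Nonempty ∧ (∀ j ∈ s, ∀ k, V j k ∈ 𝒰 j ∧ cylinder q j (V j k) = W (τ j k)) ∧
        ∀ k, ∃ j ∈ s, τ j k = k := by
  classical
  choose i U hU hUW using hW
  have key : ∀ j, ∃ (V : Fin (n + 1) → Set (Y j)) (τ : Fin (n + 1) → Fin (n + 1)),
      j ∈ range i → (∀ k, V k ∈ 𝒰 j ∧ cylinder q j (V k) = W (τ k)) ∧ ∀ k, i k = j → τ k = k := by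
    intro j
    by_cases hj : j ∈ range i
    · obtain ⟨k₀, hk₀⟩ := hj
      -- Places belonging to other factors are filled by repeating the member `k₀`.
      have : ∀ k, ∃ V ∈ 𝒰 j, cylinder q j V = W (if i k = j then k else k₀) := by
        intro k
        split_ifs with h
        · exact h ▸ ⟨U k, hU k, hUW k⟩
        · exact hk₀ ▸ ⟨U k₀, hU k₀, hUW k₀⟩
      choose V hV hVW using this
      exact ⟨V, _, fun _ => ⟨fun k => ⟨hV k, hVW k⟩, fun k hk => if_pos hk⟩⟩
    · exact ⟨fun _ => ∅, id, fun h => absurd h hj⟩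
  choose V τ h using key
  exact ⟨range i, V, τ, range_nonempty i, fun j hj => (h j hj).1,
    fun k => ⟨i k, mem_range_self k, (h _ (mem_range_self k)).2 k rfl⟩⟩

section Action

variable [∀ i, MulAction (Γ i) (X i)] [∀ i, MulAction (Γ i) (Y i)]

instance : MulAction G (Join q Y) where
  smul g := map fun i y => q i g • y
  one_smul := map_eq_self (by simp)
  mul_smul g h p := by
    change map _ p = map _ (map _ p)
    simp only [map_map, map_mul, mul_smul]

theorem smul_def (g : G) (p : Join q Y) : g • p = map (fun i y => q i g • y) p := rfl

theorem radius_smul (g : G) (p : Join q Y) : (g • p).radius = p.radius := rfl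

theorem pt_smul (g : G) (p : Join q Y) (i : ι) :
    (g • p).pt i = (p.pt i).bind fun y => .of (q i g • y) := rfl

theorem map_smul {f : ∀ i, X i → Y i} (hf : ∀ i (a : Γ i) x, f i (a • x) = a • f i x) (g : G)
    (p : Join q X) : map f (g • p) = g • map f p := by
  simp only [smul_def, map_map, hf]

theorem smul_cylinder (g : G) (i : ι) (U : Set (Y i)) :
    g • cylinder q i U = cylinder q i (q i g • U) := by
  ext p
  rw [mem_smul_set_iff_inv_smul_mem]
  simp only [cylinder, mem_ofPred_eq, pt_smul]
  cases p.pt i with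
  | bot => simp
  | of y => simp [mem_smul_set_iff_inv_smul_mem, OpenExt.of_injective.eq_iff]

theorem saturation_cylinder {i : ι} (hq : Function.Surjective (q i)) (U : Set (Y i)) :
    saturation G (cylinder q i U) = cylinder q i (saturation (Γ i) U) := by
  have : cylinder q i (saturation (Γ i) U) = ⋃ a : Γ i, cylinder q i (a • U) := by
    ext p
    simp only [cylinder, saturation, image_iUnion, mem_iUnion, mem_ofPred_eq]
  rw [this]
  simp only [saturation, smul_cylinder]
  exact hq.iUnion_comp fun a => cylinder q i (a • U)

theorem encard_orbits_joinCover_le [Fintype ι] (hq : Function.Surjective fun g i => q i g)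
    (𝒰 : ∀ i, Set (Set (Y i))) :
    ((fun W => MulAction.orbit G W) '' joinCover q 𝒰).encard ≤
      ∑ i, ((fun U => MulAction.orbit (Γ i) U) '' 𝒰 i).encard := by
  calc _ ≤ (⋃ i, (fun o => cylinder q i '' o) ''
      ((fun U => MulAction.orbit (Γ i) U) '' 𝒰 i)).encard := encard_le_encard ?_
    _ ≤ ∑ i, _ := encard_iUnion_le_of_fintype _
    _ ≤ _ := Finset.sum_le_sum fun i _ => encard_image_le _ _
  rintro _ ⟨_, ⟨i, U, hU, rfl⟩, rfl⟩
  refine mem_iUnion.2 ⟨i, _, ⟨U, hU, rfl⟩, ?_⟩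
  ext W
  constructor
  · rintro ⟨_, ⟨a, rfl⟩, rfl⟩
    obtain ⟨g, rfl⟩ := surjective_of_jointly hq i a
    exact ⟨g, smul_cylinder g i U⟩
  · rintro ⟨g, rfl⟩
    exact ⟨_, ⟨q i g, rfl⟩, (smul_cylinder g i U).symm⟩

end Action

/-! ### The topology of the join -/

variable [∀ i, TopologicalSpace (X i)] [∀ i, TopologicalSpace (Y i)] {T : Type*}
  [TopologicalSpace T]

/-- At radius zero the direction is `bot` and imposes no condition, so neighbourhoods of a cone
point are governed by the radius alone. -/
instance : TopologicalSpace (Join q Y) := .induced (fun p => (p.radius, p.pt)) inferInstance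

theorem isInducing : IsInducing fun p : Join q Y => (p.radius, p.pt) := ⟨rfl⟩

theorem continuous_radius (i : ι) : Continuous fun p : Join q Y => p.radius i :=
  (continuous_apply i).comp (continuous_fst.comp isInducing.continuous)

theorem continuous_pt (i : ι) : Continuous fun p : Join q Y => p.pt i :=
  (continuous_apply i).comp (continuous_snd.comp isInducing.continuous)

theorem continuousOn_iff {f : T → Join q Y} {s : Set T} : ContinuousOn f s ↔
    (∀ i, ContinuousOn (fun z => (f z).radius i) s) ∧
      ∀ i, ContinuousOn (fun z => (f z).pt i) s := by
  rw [isInducing.continuousOn_iff, ← continuousOn_pi, ← continuousOn_pi]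
  exact ⟨fun h => ⟨continuous_fst.comp_continuousOn h, continuous_snd.comp_continuousOn h⟩,
    fun h => h.1.prodMk h.2⟩

theorem continuous_iff {f : T → Join q Y} : Continuous f ↔
    (∀ i, Continuous fun z => (f z).radius i) ∧ ∀ i, Continuous fun z => (f z).pt i := by
  simp only [← continuousOn_univ, continuousOn_iff]

theorem continuous_map {f : ∀ i, T × X i → Y i} (hf : ∀ i, Continuous (f i)) :
    Continuous fun z : T × Join q X => map (fun i x => f i (z.1, x)) z.2 := by
  refine continuous_iff.2 ⟨fun i =>
    (continuous_radius (q := q) (Y := X) i).comp continuous_snd, fun i => ?_⟩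
  exact (OpenExt.continuous_bind (OpenExt.continuous_of.comp (hf i))).comp
    (continuous_fst.prodMk ((continuous_pt i).comp continuous_snd))

theorem continuous_map_const {f : ∀ i, X i → Y i} (hf : ∀ i, Continuous (f i)) :
    Continuous (map f : Join q X → Join q Y) :=
  (continuous_map (T := Unit) (f := fun i z => f i z.2) fun i => (hf i).comp continuous_snd).comp
    (continuous_const.prodMk continuous_id : Continuous fun p : Join q X => ((), p))

theorem isOpen_cylinder {i : ι} {U : Set (Y i)} (hU : IsOpen U) : IsOpen (cylinder q i U) :=
  (OpenExt.isOpen_image_of hU).preimage (continuous_pt i)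

variable [∀ i, MulAction (Γ i) (X i)] [∀ i, MulAction (Γ i) (Y i)]

instance [∀ i, ContinuousConstSMul (Γ i) (Y i)] : ContinuousConstSMul G (Join q Y) where
  continuous_const_smul g := continuous_map_const fun i => continuous_const_smul (q i g)

theorem gHomotopyEquivalent (h : ∀ i, GHomotopyEquivalent (Γ i) (X i) (Y i)) :
    GHomotopyEquivalent G (Join q X) (Join q Y) := by
  choose f f' hf hf' h₁ h₂ using h
  choose H hH using h₁
  choose K hK using h₂
  refine ⟨⟨map fun i => f i, continuous_map_const fun i => (f i).continuous⟩,
    ⟨map fun i => f' i, continuous_map_const fun i => (f' i).continuous⟩,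
    fun g => map_smul hf g, fun g => map_smul hf' g, ?_, ?_⟩
  · exact .of_fun _ (continuous_map fun i => (H i).continuous)
      (fun p => by simp [map_map])
      (fun p => by simpa using map_eq_self (by simp) p)
      fun g t p => map_smul (f := fun i x => H i (t, x)) (fun i a x => hH i a t x) g p
  · exact .of_fun _ (continuous_map fun i => (K i).continuous)
      (fun p => by simp [map_map])
      (fun p => by simpa using map_eq_self (by simp) p)
      fun g t p => map_smul (f := fun i x => K i (t, x)) (fun i a x => hK i a t x) g p

/-! ### Good covers of the join -/

open Classical in
/-- The point with radius one at the places in `s` and zero elsewhere. -/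
noncomputable def basePoint (q : ∀ i, G →* Γ i) (s : Set ι) (hs : s.Nonempty) (x : ∀ i ∈ s, Y i) :
    Join q Y where
  radius i := if i ∈ s then 1 else 0
  pt i := if h : i ∈ s then .of (x i h) else .bot
  nonneg i := by split_ifs <;> simp
  pt_eq_bot_iff i := by split_ifs <;> simp
  exists_ne := ⟨hs.some, by simp [hs.some_mem]⟩

/-- Contract each `A i` with i ∈ s to an orbit while the radii move linearly to 1 on `s` and to 0
elsewhere. The end is a product of `Γ i`-orbits, which is one `G`-orbit. -/
theorem isGContractible_setOf (hq : Function.Surjective fun g i => q i g) {s : Set ι}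
    (hs : s.Nonempty) {A : ∀ i, Set (Y i)} (hA : ∀ i ∈ s, IsOpen (A i))
    (hinv : ∀ i ∈ s, ∀ a : Γ i, ∀ y ∈ A i, a • y ∈ A i)
    (hc : ∀ i ∈ s, IsGContractible (Γ i) (A i)) :
    IsGContractible G {p : Join q Y | ∀ i ∈ s, p.pt i ∈ OpenExt.of '' A i} := by
  classical
  choose x hx H hH hm hG h0 h1 h1' using hc
  -- Off `s` the direction is kept until t = 1, where the radius vanishes. Both branches are
  -- continuous because `A i` and {t ≠ 1} are open.
  let F : ∀ i, I × Y i → OpenExt (Y i) := fun i =>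
    if hi : i ∈ s then fun z => if z ∈ (univ ×ˢ A i : Set (I × Y i)) then .of (H i hi z.1 z.2)
      else .bot
    else fun z => if z ∈ {z : I × Y i | z.1 ≠ 1} then .of z.2 else .bot
  have hFs : ∀ i (hi : i ∈ s) t, ∀ y ∈ A i, F i (t, y) = .of (H i hi t y) := by
    intro i hi t y hy
    simp [F, hi, hy]
  have hFn : ∀ i ∉ s, ∀ t y, F i (t, y) = if t = 1 then .bot else .of y := by
    intro i hi t y
    simp [F, hi, ite_not]
  have hF : ∀ i, Continuous (F i) := by
    intro i
    by_cases hi : i ∈ s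
    · simp only [F, dif_pos hi]
      exact OpenExt.continuous_ite (isOpen_univ.prod (hA i hi)) (hH i hi)
    · simp only [F, dif_neg hi]
      exact OpenExt.continuous_ite (isOpen_ne_fun continuous_fst continuous_const)
        continuous_snd.continuousOn
  set B := {p : Join q Y | ∀ i ∈ s, p.pt i ∈ OpenExt.of '' A i}
  have hBs : ∀ p ∈ B, ∀ i ∈ s, ∃ y ∈ A i, p.pt i = .of y := fun p hp i hi => by
    obtain ⟨y, hy, h⟩ := hp i hi
    exact ⟨y, hy, h.symm⟩
  have hrad : ∀ p ∈ B, ∀ i ∈ s, 0 < p.radius i := fun p hp i hi => radius_pos (by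
    obtain ⟨y, -, hy⟩ := hBs p hp i hi
    simp [hy])
  have hpos : ∀ (t : I) (p : Join q Y), p ∈ B → ∀ i ∈ s, 0 < (1 - t : ℝ) * p.radius i + t := by
    intro t p hp i hi
    rcases t.2.1.eq_or_lt with ht | ht
    · rw [← ht]
      simpa using hrad p hp i hi
    · have := mul_nonneg (sub_nonneg.2 t.2.2) (p.nonneg i)
      linarith
  let K : I → Join q Y → Join q Y := fun t p => if hp : p ∈ B then
    { radius := fun i => (1 - t : ℝ) * p.radius i + if i ∈ s then (t : ℝ) else 0
      pt := fun i => (p.pt i).bind fun y => F i (t, y)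
      nonneg := fun i => add_nonneg (mul_nonneg (sub_nonneg.2 t.2.2) (p.nonneg i))
        (by split_ifs; exacts [t.2.1, le_rfl])
      pt_eq_bot_iff := fun i => by
        by_cases hi : i ∈ s
        · obtain ⟨y, hy, hpy⟩ := hBs p hp i hi
          simpa [hpy, hi, hFs i hi t y hy] using (hpos t p hp i hi).ne'
        · rw [if_neg hi, add_zero, mul_eq_zero, ← p.pt_eq_bot_iff, sub_eq_zero]
          cases p.pt i with
          | bot => simp
          | of y => simp [hFn i hi, eq_comm (a := (1 : ℝ))]
      exists_ne := ⟨hs.some, by simpa [hs.some_mem] using (hpos t p hp _ hs.some_mem).ne'⟩ }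
    else p
  have hKr : ∀ t, ∀ p ∈ B, ∀ i,
      (K t p).radius i = (1 - t : ℝ) * p.radius i + if i ∈ s then (t : ℝ) else 0 := by
    intro t p hp i
    simp only [K, dif_pos hp]
  have hKp : ∀ t, ∀ p ∈ B, ∀ i, (K t p).pt i = (p.pt i).bind fun y => F i (t, y) := by
    intro t p hp i
    simp only [K, dif_pos hp]
  have hgB : ∀ (g : G), ∀ p ∈ B, g • p ∈ B := by
    intro g p hp i hi
    obtain ⟨y, hy, hpy⟩ := hBs p hp i hi
    exact ⟨q i g • y, hinv i hi _ y hy, by simp [pt_smul, hpy]⟩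
  have hbase : basePoint q s hs x ∈ B := fun i hi => ⟨x i hi, hx i hi, by simp [basePoint, hi]⟩
  refine ⟨basePoint q s hs x, hbase, K, ?_, fun t p hp i hi => ?_, fun g t p hp => ?_,
    fun p hp => ?_, fun p hp => ?_, ?_⟩
  · refine continuousOn_iff.2 ⟨fun i => ?_, fun i => ?_⟩
    · refine ContinuousOn.congr (f := fun z : I × Join q Y =>
        (1 - z.1 : ℝ) * z.2.radius i + if i ∈ s then (z.1 : ℝ) else 0) ?_
        fun z hz => hKr z.1 z.2 hz.2 i
      have := continuous_radius (q := q) (Y := Y) i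
      split_ifs <;> exact Continuous.continuousOn (by fun_prop)
    · refine ContinuousOn.congr (f := fun z : I × Join q Y =>
        (z.2.pt i).bind fun y => F i (z.1, y)) ?_ fun z hz => hKp z.1 z.2 hz.2 i
      exact ((OpenExt.continuous_bind (hF i)).comp
        (continuous_fst.prodMk ((continuous_pt i).comp continuous_snd))).continuousOn
  · obtain ⟨y, hy, hpy⟩ := hBs p hp i hi
    exact ⟨H i hi t y, hm i hi t hy, by rw [hKp t p hp, hpy, OpenExt.bind_of, hFs i hi t y hy]⟩
  · refine Join.ext (funext fun i => ?_) (funext fun i => ?_)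
    · rw [hKr t _ (hgB g p hp), radius_smul, radius_smul, hKr t p hp]
    · rw [hKp t _ (hgB g p hp), pt_smul, pt_smul, hKp t p hp]
      by_cases hi : i ∈ s
      · obtain ⟨y, hy, hpy⟩ := hBs p hp i hi
        simp [hpy, hFs i hi t y hy, hFs i hi t _ (hinv i hi (q i g) y hy), hG i hi _ t y hy]
      · cases p.pt i with
        | bot => simp
        | of y => by_cases ht : t = 1 <;> simp [hFn i hi, ht]
  · refine Join.ext (funext fun i => ?_) (funext fun i => ?_)
    · simp [hKr 0 p hp]
    · rw [hKp 0 p hp]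
      by_cases hi : i ∈ s
      · obtain ⟨y, hy, hpy⟩ := hBs p hp i hi
        simp [hpy, hFs i hi 0 y hy, h0 i hi y hy]
      · cases p.pt i <;> simp [hFn i hi]
  · choose y hy hpy using hBs p hp
    choose a ha using fun i hi => h1 i hi (y i hi) (hy i hi)
    -- One `g` realises all the orbit elements `a i` simultaneously.
    obtain ⟨g, hg⟩ := hq fun i => if hi : i ∈ s then a i hi else 1
    refine ⟨g, Join.ext (funext fun i => ?_) (funext fun i => ?_)⟩
    · simp [radius_smul, hKr 1 p hp, basePoint]
    · have hgi := congrFun hg i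
      simp only [pt_smul, hKp 1 p hp]
      by_cases hi : i ∈ s
      · simp only [dif_pos hi] at hgi
        simpa [basePoint, hi, hpy i hi, hFs i hi 1 _ (hy i hi), hgi] using ha i hi
      · cases p.pt i <;> simp [basePoint, hi, hFn i hi]
  · rintro _ ⟨g, rfl⟩
    have hB' := hgB g _ hbase
    refine Join.ext (funext fun i => ?_) (funext fun i => ?_)
    · change (K 1 (g • basePoint q s hs x)).radius i = _
      rw [hKr 1 _ hB']
      simp [radius_smul, basePoint]
    · simp only [hKp 1 _ hB', pt_smul]
      by_cases hi : i ∈ s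
      · simp [basePoint, hi, hFs i hi 1 _ (hinv i hi (q i g) _ (hx i hi)),
          h1' i hi _ ⟨q i g, rfl⟩]
      · simp [basePoint, hi]

theorem isRegularGCover_joinCover (hq : Function.Surjective fun g i => q i g)
    {𝒰 : ∀ i, Set (Set (Y i))} (h : ∀ i, IsGoodGCover (Γ i) (𝒰 i)) :
    IsRegularGCover G (joinCover q 𝒰) := by
  classical
  refine ⟨?_, ?_, ?_, ?_, ?_⟩
  · rintro _ ⟨i, U, hU, rfl⟩
    exact isOpen_cylinder ((h i).isOpen U hU)
  · refine eq_univ_of_forall fun p => ?_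
    obtain ⟨i, hi⟩ := p.exists_ne
    rw [ne_eq, ← p.pt_eq_bot_iff] at hi
    cases hp : p.pt i with
    | bot => exact absurd hp hi
    | of y =>
      obtain ⟨U, hU, hy⟩ := (h i).covers.symm ▸ mem_univ y
      exact ⟨_, ⟨i, U, hU, rfl⟩, y, hy, hp.symm⟩
  · rintro g _ ⟨i, U, hU, rfl⟩
    exact ⟨i, q i g • U, (h i).smul_mem _ U hU, (smul_cylinder g i U).symm⟩
  · rintro _ ⟨i, U, hU, rfl⟩ g
    rw [smul_cylinder]
    rcases (h i).eq_or_disjoint U hU (q i g) with h' | h'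
    · exact .inl (by rw [h'])
    · refine .inr (eq_empty_of_forall_notMem ?_)
      rintro p ⟨⟨y, hy, hpy⟩, y', hy', hpy'⟩
      obtain rfl : y = y' := OpenExt.of.inj (hpy.trans hpy'.symm)
      exact (h'.subset ⟨hy, hy'⟩).elim
  · intro n W g hW h₁ h₂
    obtain ⟨s, V, τ, -, hV, hτ⟩ := exists_of_mem_joinCover hW
    obtain ⟨p, hp⟩ := h₁
    obtain ⟨p', hp'⟩ := h₂
    rw [mem_iInter] at hp hp'
    -- Regularity of `𝒰 j` gives one element per factor; joint surjectivity then lifts them to a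
    -- single element of `G`.
    have key : ∀ j, ∃ a : Γ j, j ∈ s → ∀ k, a • V j k = q j (g (τ j k)) • V j k := by
      intro j
      by_cases hj : j ∈ s
      · have h₁ : ∀ k, p.pt j ∈ OpenExt.of '' V j k := fun k => by
          have := hp (τ j k)
          rwa [← (hV j hj k).2] at this
        have h₂ : ∀ k, p'.pt j ∈ OpenExt.of '' (q j (g (τ j k)) • V j k) := fun k => by
          have := hp' (τ j k)
          rwa [← (hV j hj k).2, smul_cylinder] at this
        rw [← mem_iInter, ← OpenExt.of_injective.injOn.image_iInter_eq] at h₁ h₂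
        obtain ⟨y, hy, -⟩ := h₁
        obtain ⟨y', hy', -⟩ := h₂
        obtain ⟨a, ha⟩ := (h j).exists_smul_eq n (V j) (fun k => q j (g (τ j k)))
          (fun k => (hV j hj k).1) ⟨y, hy⟩ ⟨y', hy'⟩
        exact ⟨a, fun _ => ha⟩
      · exact ⟨1, fun h => absurd h hj⟩
    choose a ha using key
    obtain ⟨b, hb⟩ := hq a
    refine ⟨b, fun k => ?_⟩
    obtain ⟨j, hj, hjk⟩ := hτ k
    have := congrFun hb j
    simp only at this
    rw [← hjk, ← (hV j hj k).2, smul_cylinder, this, ha j hj k, smul_cylinder, hjk]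

/-- Grouped by factor, an intersection of saturated cylinders has the form treated in
`isGContractible_setOf`. -/
theorem isGoodGCover_joinCover (hq : Function.Surjective fun g i => q i g)
    {𝒰 : ∀ i, Set (Set (Y i))} (h : ∀ i, IsGoodGCover (Γ i) (𝒰 i))
    [∀ i, ContinuousConstSMul (Γ i) (Y i)] :
    IsGoodGCover G (joinCover q 𝒰) := by
  refine (isRegularGCover_joinCover hq h).isGoodGCover ?_ fun n W hW hne => ?_
  · rintro _ ⟨i, U, hU, rfl⟩
    classical
    obtain ⟨y, hy⟩ := (h i).nonempty hU
    have hs := singleton_nonempty i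
    exact ⟨basePoint q {i} hs fun j hj => (mem_singleton_iff.1 hj).symm ▸ y, y, hy,
      by simp [basePoint]⟩
  · obtain ⟨s, V, τ, hs, hV, hτ⟩ := exists_of_mem_joinCover hW
    have hcyl : ⋂ k, saturation G (W k) =
        {p : Join q Y | ∀ j ∈ s, p.pt j ∈ OpenExt.of '' ⋂ k, saturation (Γ j) (V j k)} := by
      ext p
      simp only [mem_iInter, mem_ofPred_eq, OpenExt.of_injective.injOn.image_iInter_eq]
      constructor
      · intro hp j hj k
        have := hp (τ j k)
        rwa [← (hV j hj k).2, saturation_cylinder (surjective_of_jointly hq j)] at this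
      · intro hp k
        obtain ⟨j, hj, hjk⟩ := hτ k
        rw [← hjk, ← (hV j hj k).2, saturation_cylinder (surjective_of_jointly hq j)]
        exact hp j hj k
    rw [hcyl] at hne ⊢
    obtain ⟨p, hp⟩ := hne
    refine isGContractible_setOf hq hs (fun j hj => isOpen_iInter_of_finite fun k =>
      isOpen_iUnion fun a => ((h j).isOpen _ (hV j hj k).1).smul a) (fun j hj a y hy =>
      mem_iInter.2 fun k => smul_mem_saturation a (mem_iInter.1 hy k)) fun j hj =>
      (h j).contractible_inter n (V j) (fun k => (hV j hj k).1) ?_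
    obtain ⟨y, hy, -⟩ := hp j hj
    exact ⟨y, hy⟩

end Join

/-! ### The upper bound -/

theorem ct_le_sum_ct {ι : Type} [Fintype ι] {G : Type*} [Group G] {Γ : ι → Type*}
    [∀ i, Group (Γ i)] {q : ∀ i, G →* Γ i} (hq : Function.Surjective fun g i => q i g)
    {X : Type u} [TopologicalSpace X] [MulAction G X] {S : ι → Type u}
    [∀ i, TopologicalSpace (S i)] [∀ i, MulAction (Γ i) (S i)]
    (hX : GHomotopyEquivalent G X (Join q S)) : ct G X ≤ ∑ i, ct (Γ i) (S i) := by
  by_cases htop : ∃ i, ct (Γ i) (S i) = ⊤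
  · obtain ⟨i, hi⟩ := htop
    rw [ENat.sum_eq_top.2 ⟨i, Finset.mem_univ i, hi⟩]
    exact le_top
  push Not at htop
  have key : ∀ i, ∃ (Y : Type u) (_ : TopologicalSpace Y) (_ : MulAction (Γ i) Y)
      (_ : ContinuousConstSMul (Γ i) Y) (𝒰 : Set (Set Y)), GHomotopyEquivalent (Γ i) (S i) Y ∧
      IsGoodGCover (Γ i) 𝒰 ∧
        ((fun U => MulAction.orbit (Γ i) U) '' 𝒰).encard ≤ ct (Γ i) (S i) := by
    intro i
    -- A finite infimum in `ℕ∞` is attained: something lies strictly below `ct + 1`, hence at most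
    -- at `ct`.
    have h := (ENat.lt_add_one_iff (htop i)).2 le_rfl
    conv_lhs at h => rw [ct]
    simp only [sct, iInf_lt_iff] at h
    obtain ⟨Y, i1, i2, i3, hY, 𝒰, h𝒰, hlt⟩ := h
    exact ⟨Y, i1, i2, i3, 𝒰, hY, h𝒰, (ENat.lt_add_one_iff (htop i)).1 hlt⟩
  choose Y i1 i2 i3 𝒰 hY h𝒰 hle using key
  exact iInf_le_of_le (Join q Y) <| iInf_le_of_le inferInstance <| iInf_le_of_le inferInstance <|
    iInf_le_of_le inferInstance <| iInf_le_of_le (hX.trans (Join.gHomotopyEquivalent hY)) <|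
    iInf_le_of_le (Join.joinCover q 𝒰) <| iInf_le_of_le (Join.isGoodGCover_joinCover hq h𝒰) <|
    (Join.encard_orbits_joinCover_le hq 𝒰).trans (Finset.sum_le_sum fun i _ => hle i)

/-! ### Unit spheres of orthogonal representations -/

namespace RepSphere

variable {G V : Type*} [Group G] [NormedAddCommGroup V] [InnerProductSpace ℝ V]
  {ρ : G →* (V ≃ₗᵢ[ℝ] V)}

/-- The unit vector underlying a point of the sphere of a representation. -/
def vec (x : RepSphere ρ) : V := Subtype.val (p := (· ∈ Metric.sphere (0 : V) 1)) x

theorem norm_vec (x : RepSphere ρ) : ‖x.vec‖ = 1 :=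
  mem_sphere_zero_iff_norm.1 (Subtype.property (p := (· ∈ Metric.sphere (0 : V) 1)) x)

theorem vec_ne_zero (x : RepSphere ρ) : x.vec ≠ 0 :=
  norm_ne_zero_iff.1 (by simp [norm_vec])

/-- The point of the sphere given by a unit vector. -/
def mk (v : V) (hv : ‖v‖ = 1) : RepSphere ρ :=
  (⟨v, mem_sphere_zero_iff_norm.2 hv⟩ : Metric.sphere (0 : V) 1)

@[simp] theorem vec_mk (v : V) (hv : ‖v‖ = 1) : (mk v hv : RepSphere ρ).vec = v := rfl

theorem ext {x y : RepSphere ρ} (h : x.vec = y.vec) : x = y := Subtype.ext h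

theorem vec_smul (g : G) (x : RepSphere ρ) : (g • x).vec = ρ g x.vec := rfl

theorem isInducing_vec : IsInducing (vec : RepSphere ρ → V) := ⟨rfl⟩

theorem continuous_vec : Continuous (vec : RepSphere ρ → V) := isInducing_vec.continuous

/-- The radial projection of a nonzero vector to the sphere. -/
noncomputable def normalize (v : V) (hv : v ≠ 0) : RepSphere ρ :=
  mk (‖v‖⁻¹ • v) (norm_smul_inv_norm hv)

theorem vec_normalize (v : V) (hv : v ≠ 0) : (normalize v hv : RepSphere ρ).vec = ‖v‖⁻¹ • v := rfl

theorem smul_normalize (g : G) (v : V) (hv : v ≠ 0) :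
    g • (normalize v hv : RepSphere ρ) = normalize (ρ g v) (by simpa using hv) :=
  ext (by simp [vec_smul, vec_normalize])

theorem continuous_normalize {T : Type*} [TopologicalSpace T] {f : T → V} (hf : Continuous f)
    (h : ∀ t, f t ≠ 0) : Continuous fun t => (normalize (f t) (h t) : RepSphere ρ) :=
  isInducing_vec.continuous_iff.2 ((hf.norm.inv₀ fun t => norm_ne_zero_iff.2 (h t)).smul hf)

/-- The vector underlying a point of the sphere, extended by zero. -/
def extVec : OpenExt (RepSphere ρ) → V
  | .bot => 0
  | .of x => x.vec

theorem norm_extVec_le (o : OpenExt (RepSphere ρ)) : ‖extVec o‖ ≤ 1 := by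
  cases o with
  | bot => simp [extVec]
  | of x => exact (norm_vec x).le

/-- Continuity fails at `bot` once the sphere is nonempty; in `toVec` the factor `radius` makes up
for it, `extVec` being bounded. -/
theorem continuousAt_extVec (x : RepSphere ρ) : ContinuousAt extVec (.of x) :=
  OpenExt.isOpenEmbedding_of.continuousAt_iff.1 continuous_vec.continuousAt

end RepSphere

/-! ### The sphere of a direct sum as a join -/

section DirectSum

variable {r : ℕ} {G : Type*} [Group G] {Γ : Fin r → Type*} [∀ i, Group (Γ i)]
  {q : ∀ i, G →* Γ i} {V : Fin r → Type*} [∀ i, NormedAddCommGroup (V i)]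
  [∀ i, InnerProductSpace ℝ (V i)] {ρ : ∀ i, Γ i →* (V i ≃ₗᵢ[ℝ] V i)}

theorem directSum_apply (ρ' : ∀ i, G →* (V i ≃ₗᵢ[ℝ] V i)) (g : G) (v : PiLp 2 V) (i : Fin r) :
    directSum ρ' g v i = ρ' i g (v i) := rfl

namespace Join

/-- The vector with components of the given radii and directions. -/
noncomputable def toVec (p : Join q fun i => RepSphere (ρ i)) : PiLp 2 V :=
  WithLp.toLp 2 fun i => p.radius i • RepSphere.extVec (p.pt i)

theorem toVec_apply (p : Join q fun i => RepSphere (ρ i)) (i : Fin r) :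
    p.toVec i = p.radius i • RepSphere.extVec (p.pt i) := rfl

theorem norm_toVec_apply (p : Join q fun i => RepSphere (ρ i)) (i : Fin r) :
    ‖p.toVec i‖ = p.radius i := by
  have h := p.pt_eq_bot_iff i
  rw [toVec_apply, norm_smul, Real.norm_of_nonneg (p.nonneg i)]
  cases hp : p.pt i with
  | bot => simp [h.1 hp]
  | of x => simp [RepSphere.extVec, RepSphere.norm_vec]

theorem toVec_ne_zero (p : Join q fun i => RepSphere (ρ i)) : p.toVec ≠ 0 := fun h => by
  obtain ⟨i, hi⟩ := p.exists_ne
  exact hi (by rw [← norm_toVec_apply, h]; simp)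

theorem toVec_smul (g : G) (p : Join q fun i => RepSphere (ρ i)) :
    (g • p).toVec = directSum (fun i => (ρ i).comp (q i)) g p.toVec := by
  ext i
  rw [directSum_apply, toVec_apply, toVec_apply, radius_smul, pt_smul]
  cases p.pt i with
  | bot => simp [RepSphere.extVec]
  | of x => simp [RepSphere.extVec, RepSphere.vec_smul]

theorem continuous_toVec :
    Continuous (toVec : Join q (fun i => RepSphere (ρ i)) → PiLp 2 V) := by
  refine (PiLp.continuous_toLp 2 V).comp (continuous_pi fun i => ?_)
  refine continuous_iff_continuousAt.2 fun p => ?_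
  have hr := (continuous_radius (q := q) (Y := fun i => RepSphere (ρ i)) i).continuousAt (x := p)
  cases hp : p.pt i with
  | bot =>
    have h0 := (p.pt_eq_bot_iff i).1 hp
    rw [ContinuousAt, h0] at hr
    rw [ContinuousAt, h0, zero_smul]
    exact squeeze_zero_norm (fun p' => by
      rw [norm_smul, Real.norm_of_nonneg (p'.nonneg i)]
      exact mul_le_of_le_one_right (p'.nonneg i) (RepSphere.norm_extVec_le _)) hr
  | of x =>
    have hx := RepSphere.continuousAt_extVec x
    rw [← hp] at hx
    exact hr.smul (hx.comp (f := fun p : Join q (fun i => RepSphere (ρ i)) => p.pt i)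
      (continuous_pt i).continuousAt)

/-- Rescaling all radii. -/
def scale {Y : Fin r → Type*} (c : ℝ) (hc : 0 < c) (p : Join q Y) : Join q Y where
  radius i := c * p.radius i
  pt := p.pt
  nonneg i := mul_nonneg hc.le (p.nonneg i)
  pt_eq_bot_iff i := by rw [p.pt_eq_bot_iff, mul_eq_zero, or_iff_right hc.ne']
  exists_ne := p.exists_ne.imp fun i hi => mul_ne_zero hc.ne' hi

open Classical in
/-- The radii and directions of the components of a vector. -/
noncomputable def ofVec (q : ∀ i, G →* Γ i) (ρ : ∀ i, Γ i →* (V i ≃ₗᵢ[ℝ] V i)) (v : PiLp 2 V)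
    (hv : v ≠ 0) : Join q fun i => RepSphere (ρ i) where
  radius i := ‖v i‖
  pt i := if h : v i ∈ ({0}ᶜ : Set (V i)) then .of (RepSphere.normalize (v i) h) else .bot
  nonneg i := norm_nonneg _
  pt_eq_bot_iff i := by
    split_ifs with h
    · simpa using h
    · simpa using h
  exists_ne := by
    by_contra! h
    exact hv (PiLp.ext fun i => norm_eq_zero.1 (h i))

theorem toVec_ofVec (v : PiLp 2 V) (hv : v ≠ 0) : (ofVec q ρ v hv).toVec = v := by
  ext i
  rw [toVec_apply]
  by_cases h : v i = 0
  · simp [ofVec, h]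
  · simp only [ofVec, mem_compl_singleton_iff, ne_eq, h, not_false_eq_true, dif_pos,
      RepSphere.extVec]
    exact smul_inv_smul₀ (norm_ne_zero_iff.2 h) (v i)

/-- Polar coordinates are unique, so identities in the join can be checked on vectors. -/
theorem toVec_injective :
    Function.Injective (toVec : Join q (fun i => RepSphere (ρ i)) → PiLp 2 V) := by
  intro p p' h
  have hr : p.radius = p'.radius := funext fun i => by
    rw [← norm_toVec_apply, h, norm_toVec_apply]
  refine Join.ext hr (funext fun i => ?_)
  have hi := congrArg (fun v => v i) h
  simp only [toVec_apply, hr] at hi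
  have h₁ := p.pt_eq_bot_iff i
  have h₂ := p'.pt_eq_bot_iff i
  rw [hr] at h₁
  by_cases h0 : p'.radius i = 0
  · rw [h₁.2 h0, h₂.2 h0]
  · have := smul_right_injective _ h0 hi
    cases hp : p.pt i with
    | bot => exact absurd (h₁.1 hp) h0
    | of x => cases hp' : p'.pt i with
      | bot => exact absurd (h₂.1 hp') h0
      | of x' =>
        rw [hp, hp'] at this
        exact congrArg _ (RepSphere.ext this)

theorem toVec_scale (c : ℝ) (hc : 0 < c) (p : Join q fun i => RepSphere (ρ i)) :
    (scale c hc p).toVec = c • p.toVec := by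
  ext i
  rw [PiLp.smul_apply, toVec_apply, toVec_apply, smul_smul]
  rfl

theorem continuous_ofVec {T : Type*} [TopologicalSpace T] {f : T → PiLp 2 V} (hf : Continuous f)
    (h : ∀ t, f t ≠ 0) : Continuous fun t => ofVec q ρ (f t) (h t) := by
  classical
  have hi : ∀ i, Continuous fun t => f t i := fun i => (PiLp.continuous_apply 2 V i).comp hf
  refine continuous_iff.2 ⟨fun i => (hi i).norm, fun i => ?_⟩
  have : Continuous fun v : V i => if h : v ∈ ({0}ᶜ : Set (V i)) then
      OpenExt.of (RepSphere.normalize v h : RepSphere (ρ i)) else .bot :=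
    OpenExt.continuous_dite isOpen_compl_singleton
      (RepSphere.continuous_normalize continuous_subtype_val fun v => v.2)
  convert this.comp (hi i) using 1
  funext t
  simp only [ofVec, Function.comp_apply]

end Join

/-- By `toVec` and `ofVec` the join is the space of nonzero vectors, which retracts radially onto
the sphere. -/
theorem RepSphere.gHomotopyEquivalent_join (q : ∀ i, G →* Γ i)
    (ρ : ∀ i, Γ i →* (V i ≃ₗᵢ[ℝ] V i)) :
    GHomotopyEquivalent G (RepSphere (directSum fun i => (ρ i).comp (q i)))
      (Join q fun i => RepSphere (ρ i)) := by
  refine ⟨⟨_, Join.continuous_ofVec RepSphere.continuous_vec RepSphere.vec_ne_zero⟩,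
    ⟨_, RepSphere.continuous_normalize Join.continuous_toVec Join.toVec_ne_zero⟩,
    fun g x => ?_, fun g p => ?_, ?_, ?_⟩
  · exact Join.toVec_injective (by simp [Join.toVec_ofVec, Join.toVec_smul, RepSphere.vec_smul])
  · simp only [ContinuousMap.coe_mk, RepSphere.smul_normalize, Join.toVec_smul]
  · refine .of_eq (fun g x => ?_) fun x => ?_
    · exact RepSphere.ext (by simp [RepSphere.vec_normalize, RepSphere.vec_smul, Join.toVec_ofVec])
    · exact RepSphere.ext (by simp [RepSphere.vec_normalize, Join.toVec_ofVec, RepSphere.norm_vec])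
  · have hN : ∀ p : Join q fun i => RepSphere (ρ i), 0 < ‖p.toVec‖⁻¹ := fun p =>
      inv_pos.2 (norm_pos_iff.2 p.toVec_ne_zero)
    have hpos : ∀ (t : I) (p : Join q fun i => RepSphere (ρ i)),
        0 < (1 - t : ℝ) * ‖p.toVec‖⁻¹ + t := by
      intro t p
      rcases t.2.1.eq_or_lt with ht | ht
      · rw [← ht]
        simpa using p.toVec_ne_zero
      · have := mul_nonneg (sub_nonneg.2 t.2.2) (hN p).le
        linarith
    -- The scaling factor runs from 1/‖v‖ to 1.
    refine .of_fun (fun z => Join.scale _ (hpos z.1 z.2) z.2) ?_ (fun p => ?_) (fun p => ?_)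
      fun g t p => ?_
    · have hv : Continuous fun z : I × Join q fun i => RepSphere (ρ i) => ‖z.2.toVec‖⁻¹ :=
        (Join.continuous_toVec.comp continuous_snd).norm.inv₀
          fun z => norm_ne_zero_iff.2 z.2.toVec_ne_zero
      have hpt : ∀ i, Continuous fun z : I × Join q fun i => RepSphere (ρ i) => z.2.pt i :=
        fun i => (Join.continuous_pt i).comp continuous_snd
      refine Join.continuous_iff.2 ⟨fun i => ?_, hpt⟩
      have hr := Join.continuous_radius (q := q) (Y := fun i => RepSphere (ρ i)) i
      exact ((((by fun_prop : Continuous fun z : I × Join q fun i => RepSphere (ρ i) =>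
        (1 - z.1 : ℝ))).mul hv).add (by fun_prop)).mul (hr.comp continuous_snd)
    · exact Join.toVec_injective
        (by simp [Join.toVec_scale, Join.toVec_ofVec, RepSphere.vec_normalize])
    · exact Join.toVec_injective (by simp [Join.toVec_scale])
    · exact Join.toVec_injective (by simp [Join.toVec_scale, Join.toVec_smul])

/-! ### Fixed points in the sphere of a direct sum -/

theorem RepSphere.exists_smul_ne (hfix : ∀ i (v : V i), (∀ g, ρ i (q i g) v = v) → v = 0)
    (x : RepSphere (directSum fun i => (ρ i).comp (q i))) :
    ∃ g : G, g • x ≠ x := by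
  by_contra! h
  exact x.vec_ne_zero (PiLp.ext fun i => hfix i _ fun g =>
    congrArg (fun y : RepSphere (directSum fun i => (ρ i).comp (q i)) => y.vec i) (h g))

/-- The kernel of `q i` already acts on `V j` through all of the image of `q j`, so the `j`-th
component is a fixed vector. -/
theorem RepSphere.vec_apply_eq_zero (hq : Function.Surjective fun g i => q i g) {i j : Fin r}
    (hij : i ≠ j) (hfix : ∀ v : V j, (∀ g, ρ j (q j g) v = v) → v = 0)
    (x : KerFixed (q i) (surjective_of_jointly hq i)
      (RepSphere (directSum fun i => (ρ i).comp (q i)))) : x.val.vec j = 0 := by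
  refine hfix _ fun g => ?_
  obtain ⟨a, b, rfl, ha, hb⟩ := exists_eq_mul_of_jointly hq hij g
  rw [map_mul, hb, mul_one]
  exact congrArg (fun y : RepSphere (directSum fun i => (ρ i).comp (q i)) => y.vec j)
    (x.smul_val a ha)

/-- The inclusion of the sphere of a summand into the sphere of a direct sum. -/
noncomputable def RepSphere.single (q : ∀ i, G →* Γ i) (i : Fin r) (x : RepSphere (ρ i)) :
    RepSphere (directSum fun i => (ρ i).comp (q i)) :=
  .mk (PiLp.single 2 i x.vec) (by rw [PiLp.norm_single, x.norm_vec])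

theorem RepSphere.smul_single (g : G) (i : Fin r) (x : RepSphere (ρ i)) :
    g • single q i x = single q i (q i g • x) := by
  refine RepSphere.ext (PiLp.ext fun j => ?_)
  rw [vec_smul, directSum_apply]
  rcases eq_or_ne j i with rfl | h
  · simp [single, vec_smul]
  · simp [single, h]

/-- Only the `i`-th component of a fixed point survives, and ker (q i) acts trivially on it: the
fixed set is a copy of S(V i). -/
theorem RepSphere.gHomotopyEquivalent_kerFixed (hq : Function.Surjective fun g i => q i g)
    (hfix : ∀ i (v : V i), (∀ g, ρ i (q i g) v = v) → v = 0) (i : Fin r) :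
    GHomotopyEquivalent (Γ i) (RepSphere (ρ i)) (KerFixed (q i) (surjective_of_jointly hq i)
      (RepSphere (directSum fun i => (ρ i).comp (q i)))) := by
  have hs : ∀ x : KerFixed (q i) (surjective_of_jointly hq i)
      (RepSphere (directSum fun i => (ρ i).comp (q i))),
      x.val.vec = PiLp.single 2 i (x.val.vec i) := fun x => PiLp.ext fun j => by
    rcases eq_or_ne j i with rfl | h
    · simp
    · rw [vec_apply_eq_zero hq h.symm (hfix j) x]
      simp [h]
  have hn : ∀ x : KerFixed (q i) (surjective_of_jointly hq i)
      (RepSphere (directSum fun i => (ρ i).comp (q i))), ‖x.val.vec i‖ = 1 := fun x => by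
    rw [← x.val.norm_vec, hs x, PiLp.norm_single]
    simp
  let f : C(RepSphere (ρ i), KerFixed (q i) (surjective_of_jointly hq i)
      (RepSphere (directSum fun i => (ρ i).comp (q i)))) :=
    ⟨fun x => ⟨single q i x, fun g hg => by rw [smul_single, hg, one_smul]⟩,
      KerFixed.isInducing_val.continuous_iff.2 (isInducing_vec.continuous_iff.2
        ((PiLp.continuous_toLp 2 V).comp ((continuous_single i).comp continuous_vec)))⟩
  let f' : C(KerFixed (q i) (surjective_of_jointly hq i)
      (RepSphere (directSum fun i => (ρ i).comp (q i))), RepSphere (ρ i)) :=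
    ⟨fun x => .mk (x.val.vec i) (hn x), isInducing_vec.continuous_iff.2
      ((PiLp.continuous_apply 2 V i).comp
        (continuous_vec.comp KerFixed.isInducing_val.continuous))⟩
  have hf : IsGMap (Γ i) f := fun a x => by
    obtain ⟨g, rfl⟩ := surjective_of_jointly hq i a
    refine KerFixed.ext ?_
    rw [KerFixed.val_map_smul]
    exact (smul_single g i x).symm
  have hf' : IsGMap (Γ i) f' := fun a x => by
    obtain ⟨g, rfl⟩ := surjective_of_jointly hq i a
    refine RepSphere.ext ?_
    change (q i g • x).val.vec i = _
    rw [KerFixed.val_map_smul]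
    rfl
  refine ⟨f, f', hf, hf', .of_eq (fun g x => ?_) fun x => ?_, .of_eq (fun g x => ?_) fun x => ?_⟩
  · simp [hf g, hf' g]
  · exact RepSphere.ext (by simp [f, f', single])
  · simp [hf g, hf' g]
  · exact KerFixed.ext (RepSphere.ext (hs x).symm)

/-- The covering type of the sphere of a direct sum of representations without nonzero fixed
vectors, pulled back along jointly surjective homomorphisms. -/
theorem ct_repSphere_directSum (hq : Function.Surjective fun g i => q i g)
    (hfix : ∀ i (v : V i), (∀ g, ρ i (q i g) v = v) → v = 0) :
    ct G (RepSphere (directSum fun i => (ρ i).comp (q i))) = ∑ i, ct (Γ i) (RepSphere (ρ i)) :=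
  le_antisymm (ct_le_sum_ct hq (RepSphere.gHomotopyEquivalent_join q ρ))
    (sum_ct_le_ct hq (RepSphere.exists_smul_ne hfix)
      (RepSphere.gHomotopyEquivalent_kerFixed hq hfix))

end DirectSum

/-! ### Joint surjectivity from the Chinese remainder theorem -/

theorem surjective_projFactor {r : ℕ} (p k : Fin r → ℕ) (hp : ∀ i, (p i).Prime)
    (hpinj : Function.Injective p) :
    Function.Surjective fun (g : Multiplicative (ZMod (∏ j, p j ^ k j))) i =>
      projFactor p k i g := by
  intro a
  have hco : Pairwise (Function.onFun Nat.Coprime fun j => p j ^ k j) := fun i j hij =>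
    Nat.Coprime.pow _ _ ((Nat.coprime_primes (hp i) (hp j)).2 (hpinj.ne hij))
  obtain ⟨z, hz⟩ := (ZMod.prodEquivPi _ hco).surjective fun i => (a i).toAdd
  refine ⟨Multiplicative.ofAdd z, funext fun i => ?_⟩
  have := congrFun hz i
  rw [ZMod.prodEquivPi_apply] at this
  exact congrArg Multiplicative.ofAdd this

end EquivCov

theorem mainTheorem9 {r : ℕ} (p k : Fin r → ℕ) (hp : ∀ i, (p i).Prime)
    (hpinj : Function.Injective p)
    (V : Fin r → Type*) [∀ i, NormedAddCommGroup (V i)] [∀ i, InnerProductSpace ℝ (V i)]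
    [∀ i, FiniteDimensional ℝ (V i)]
    (ρ : ∀ i, Multiplicative (ZMod (p i ^ k i)) →* (V i ≃ₗᵢ[ℝ] V i))
    (hfix : ∀ (i : Fin r) (v : V i),
      (∀ g : Multiplicative (ZMod (∏ j, p j ^ k j)), ρ i (EquivCov.projFactor p k i g) v = v) →
        v = 0) :
    EquivCov.ct (Multiplicative (ZMod (∏ j, p j ^ k j)))
        (EquivCov.RepSphere
          (EquivCov.directSum fun i => (ρ i).comp (EquivCov.projFactor p k i))) =
      ∑ i, EquivCov.ct (Multiplicative (ZMod (p i ^ k i))) (EquivCov.RepSphere (ρ i)) :=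
  EquivCov.ct_repSphere_directSum (EquivCov.surjective_projFactor p k hp hpinj) hfix
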